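/- Let $A$ be a C*-algebra and let $E$ be a Hilbert $A$-module. Write $L(E)$ for the C*-algebra of adjointable endomorphisms of $E$, and $K(E)\subseteq L(E)$ for the compact endomorphisms, i.e. the norm closure of the linear span of the rank-one maps $\theta_{x,y}$, sending $z$ to $x$ multiplied by the module action of $\langle y,z\rangle$. For a self-adjoint $h\in L(E)$ and $t\in\mathbb R$, let $1_{]t,+\infty]}(h)$ be the corresponding spectral projection in the bidual $K(E)''$; it is the supremum (and weak* limit) of the increasing sequence $f_n(h)$, $f_n(s)=\min(1,\,n\max(s-t,0))$. Let $E_t(h)$ be the closed submodule of $E$ corresponding to this (open) projection, $E_t(h)=\{\xi\in E:\ 1_{]t,+\infty]}(h)\,\xi=\xi \text{ in the bidual } E''\}$, i.e. the set of all $\xi\in E$ such that $\ell(f_n(h)\xi)\to\ell(\xi)$ for every bounded linear functional $\ell$ on $E$. Let $h_1,h_2\in K(E)$ be self-adjoint with $\|h_1-h_2\|\le\varepsilon$. Then for every $t\in\mathbb R$ there is a closed submodule $F$ of $E$ with $F\subseteq E_{t-\varepsilon}(h_2)$ such that $E_t(h_1)$ is isomorphic to $F$ as a Hilbert $A$-module,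 i.e. there is a bijective $A$-linear map $E_t(h_1)\to F$ preserving the $A$-valued inner product. -/

import Mathlib

open Filter Topology

noncomputable section

/-!
Hilbert C⋆-modules are Mathlib's `CStarModule`s which are complete.  Mathlib writes the module
action on the left, `⟪x, a • y⟫ = a * ⟪x, y⟫`; a right Hilbert module over `B` is the same thing as
a `CStarModule` over `A = Bᵐᵒᵖ`.
-/
namespace HilbertMod

section Action

variable {A E : Type*} [NonUnitalCStarAlgebra A] [PartialOrder A] [AddCommGroup E] [Module ℂ E]
  [SMul A E] [Norm E] [CStarModule A E]

theorem ext_inner {x y : E} (h : ∀ z : E, inner A z x = inner A z y) : x = y := by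
  have h1 : inner A (x - y) (x - y) = 0 := by
    rw [CStarModule.inner_sub_right, h, sub_self]
  exact sub_eq_zero.mp ((CStarModule.inner_self (A := A)).mp h1)

theorem add_smul' (a b : A) (x : E) : (a + b) • x = a • x + b • x :=
  ext_inner (A := A) fun z => by simp [add_mul]

theorem smul_add' (a : A) (x y : E) : a • (x + y) = a • x + a • y :=
  ext_inner (A := A) fun z => by simp [mul_add]

theorem smul_zero' (a : A) : a • (0 : E) = 0 :=
  ext_inner (A := A) fun z => by simp

theorem smul_smul_complex (c : ℂ) (a : A) (x : E) : (c • a) • x = c • (a • x) :=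
  ext_inner (A := A) fun z => by simp [smul_mul_assoc]

theorem smul_complex_smul (c : ℂ) (a : A) (x : E) : a • (c • x) = c • (a • x) :=
  ext_inner (A := A) fun z => by simp [mul_smul_comm]

end Action

section NormBound

variable {A E : Type*} [NonUnitalCStarAlgebra A] [PartialOrder A]
  [NormedAddCommGroup E] [NormedSpace ℂ E] [SMul A E] [CStarModule A E]

theorem norm_smul_le' (a : A) (x : E) : ‖a • x‖ ≤ ‖a‖ * ‖x‖ := by
  refine abs_le_of_sq_le_sq' ?_ (by positivity) |>.2
  rw [mul_pow, CStarModule.norm_sq_eq A, CStarModule.norm_sq_eq A (x := x)]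
  simp only [CStarModule.inner_op_smul_right, CStarModule.inner_op_smul_left]
  calc ‖a * (inner A x x * star a)‖ ≤ ‖a‖ * (‖inner A x x‖ * ‖star a‖) :=
        (norm_mul_le _ _).trans (by gcongr; exact norm_mul_le _ _)
    _ = ‖a‖ ^ 2 * ‖inner A x x‖ := by rw [norm_star]; ring

/-- The action of a single `a : A` as a continuous map. -/
def lsmul (a : A) : E →L[ℂ] E :=
  LinearMap.mkContinuous
    { toFun := fun x => a • x
      map_add' := smul_add' a
      map_smul' := fun c x => smul_complex_smul c a x } ‖a‖ (norm_smul_le' a)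

@[simp] theorem lsmul_apply (a : A) (x : E) : lsmul a x = a • x := rfl

end NormBound

/-! ### Adjointable endomorphisms -/

section Adjointable

variable (A E : Type*) [NonUnitalCStarAlgebra A] [PartialOrder A]
  [NormedAddCommGroup E] [NormedSpace ℂ E] [SMul A E] [CStarModule A E]

/-- The algebra `L(E)` of adjointable endomorphisms of a Hilbert module `E`, with the operator
norm.  (Adjointable maps are automatically `A`-linear, see `map_smul`.) -/
def AdjointableEnd : Subalgebra ℂ (E →L[ℂ] E) where
  carrier := {T | ∃ S : E →L[ℂ] E, ∀ x y : E, inner A (T x) y = inner A x (S y)}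
  mul_mem' := by
    rintro T₁ T₂ ⟨S₁, h₁⟩ ⟨S₂, h₂⟩
    exact ⟨S₂ * S₁, fun x y => by simp [h₁, h₂]⟩
  add_mem' := by
    rintro T₁ T₂ ⟨S₁, h₁⟩ ⟨S₂, h₂⟩
    exact ⟨S₁ + S₂, fun x y => by simp [h₁, h₂]⟩
  algebraMap_mem' c := ⟨algebraMap ℂ _ (star c), fun x y => by
    simp [Algebra.algebraMap_eq_smul_one]⟩

variable {A E}

namespace AdjointableEnd

/-- The adjoint of an adjointable endomorphism, as a bounded operator. -/
def adj (T : AdjointableEnd A E) : E →L[ℂ] E := T.2.choose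

theorem inner_left (T : AdjointableEnd A E) (x y : E) :
    inner A (T.1 x) y = inner A x (adj T y) := T.2.choose_spec x y

theorem inner_right (T : AdjointableEnd A E) (x y : E) :
    inner A (adj T x) y = inner A x (T.1 y) := by
  rw [← CStarModule.star_inner, ← inner_left, CStarModule.star_inner]

theorem map_smul (T : AdjointableEnd A E) (a : A) (x : E) : T.1 (a • x) = a • T.1 x :=
  ext_inner (A := A) fun z => by simp [← inner_right]

instance : Star (AdjointableEnd A E) := ⟨fun T => ⟨adj T, T.1, inner_right T⟩⟩

theorem star_inner_left (T : AdjointableEnd A E) (x y : E) :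
    inner A ((star T).1 x) y = inner A x (T.1 y) := inner_right T x y

theorem ext_left {S T : AdjointableEnd A E}
    (h : ∀ x y : E, inner A x (S.1 y) = inner A x (T.1 y)) : S = T :=
  Subtype.ext <| ContinuousLinearMap.ext fun y => ext_inner (A := A) fun x => h x y

theorem star_inner_right (T : AdjointableEnd A E) (x y : E) :
    inner A x ((star T).1 y) = inner A (T.1 x) y := (inner_left T x y).symm

instance : StarRing (AdjointableEnd A E) where
  star_involutive T := ext_left fun x y => by rw [star_inner_right, star_inner_left]
  star_mul S T := ext_left fun x y => by
    rw [star_inner_right]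
    change inner A (S.1 (T.1 x)) y = inner A x ((star T).1 ((star S).1 y))
    rw [star_inner_right, star_inner_right]
  star_add S T := ext_left fun x y => by
    rw [star_inner_right]
    change inner A (S.1 x + T.1 x) y = inner A x ((star S).1 y + (star T).1 y)
    rw [CStarModule.inner_add_left, CStarModule.inner_add_right, star_inner_right,
      star_inner_right]

instance : StarModule ℂ (AdjointableEnd A E) where
  star_smul c T := ext_left fun x y => by
    rw [star_inner_right]
    change inner A (c • T.1 x) y = inner A x (star c • (star T).1 y)
    rw [CStarModule.inner_smul_left_complex, CStarModule.inner_smul_right_complex,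
      star_inner_right]

variable [StarOrderedRing A]

instance : CStarRing (AdjointableEnd A E) where
  norm_mul_self_le T := by
    have h : ‖T.1‖ ≤ √‖(star T * T).1‖ := by
      refine ContinuousLinearMap.opNorm_le_bound _ (Real.sqrt_nonneg _) fun x => ?_
      refine abs_le_of_sq_le_sq' ?_ (by positivity) |>.2
      rw [mul_pow, Real.sq_sqrt (norm_nonneg _), CStarModule.norm_sq_eq A, ← star_inner_right]
      calc ‖inner A x ((star T * T).1 x)‖ ≤ ‖x‖ * ‖(star T * T).1 x‖ :=
            CStarModule.norm_inner_le E
        _ ≤ ‖x‖ * (‖(star T * T).1‖ * ‖x‖) := by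
            gcongr; exact ContinuousLinearMap.le_opNorm _ _
        _ = ‖(star T * T).1‖ * ‖x‖ ^ 2 := by ring
    calc ‖T‖ * ‖T‖ ≤ √‖(star T * T).1‖ * √‖(star T * T).1‖ :=
          mul_le_mul h h (norm_nonneg _) (Real.sqrt_nonneg _)
      _ = ‖star T * T‖ := Real.mul_self_sqrt (norm_nonneg _)

instance [CompleteSpace E] : CompleteSpace (AdjointableEnd A E) := by
  refine Metric.complete_of_cauchySeq_tendsto fun u hu => ?_
  have hS : CauchySeq fun n => (u n).1 :=
    (uniformContinuous_subtype_val).comp_cauchySeq hu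
  have hT : CauchySeq fun n => (star (u n)).1 :=
    (uniformContinuous_subtype_val.comp
      (starₗᵢ ℂ : AdjointableEnd A E ≃ₗᵢ⋆[ℂ] AdjointableEnd A E).isometry.uniformContinuous
      ).comp_cauchySeq hu
  obtain ⟨S, hS⟩ := cauchySeq_tendsto_of_complete hS
  obtain ⟨T, hT⟩ := cauchySeq_tendsto_of_complete hT
  have key : ∀ x y : E, inner A (S x) y = inner A x (T y) := fun x y => by
    have h1 : Tendsto (fun n => inner A ((u n).1 x) y) atTop (𝓝 (inner A (S x) y)) :=
      ((CStarModule.continuous_inner (A := A) (E := E)).tendsto (S x, y)).comp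
        ((((ContinuousLinearMap.apply ℂ E x).continuous.tendsto S).comp hS).prodMk_nhds tendsto_const_nhds)
    have h2 : Tendsto (fun n => inner A x ((star (u n)).1 y)) atTop (𝓝 (inner A x (T y))) :=
      ((CStarModule.continuous_inner (A := A) (E := E)).tendsto (x, T y)).comp
        (tendsto_const_nhds.prodMk_nhds (((ContinuousLinearMap.apply ℂ E y).continuous.tendsto T).comp hT))
    exact tendsto_nhds_unique h1 (by simpa only [star_inner_right] using h2)
  exact ⟨⟨S, T, key⟩, tendsto_subtype_rng.mpr hS⟩

/-- `L(E)` is a C⋆-algebra. -/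
instance [CompleteSpace E] : CStarAlgebra (AdjointableEnd A E) where

/-- The rank one endomorphism `z ↦ ⟪y, z⟫ • x`. -/
def rankOne (x y : E) : AdjointableEnd A E :=
  ⟨LinearMap.mkContinuous
    { toFun := fun z => inner A y z • x
      map_add' := fun z w => by rw [CStarModule.inner_add_right, add_smul']
      map_smul' := fun c z => by
        rw [CStarModule.inner_smul_right_complex, smul_smul_complex, RingHom.id_apply] }
    (‖y‖ * ‖x‖) fun z => by
      calc ‖inner A y z • x‖ ≤ ‖inner A y z‖ * ‖x‖ := norm_smul_le' _ _
        _ ≤ ‖y‖ * ‖z‖ * ‖x‖ := by gcongr; exact CStarModule.norm_inner_le E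
        _ = ‖y‖ * ‖x‖ * ‖z‖ := by ring,
    LinearMap.mkContinuous
    { toFun := fun z => inner A x z • y
      map_add' := fun z w => by rw [CStarModule.inner_add_right, add_smul']
      map_smul' := fun c z => by
        rw [CStarModule.inner_smul_right_complex, smul_smul_complex, RingHom.id_apply] }
    (‖x‖ * ‖y‖) fun z => by
      calc ‖inner A x z • y‖ ≤ ‖inner A x z‖ * ‖y‖ := norm_smul_le' _ _
        _ ≤ ‖x‖ * ‖z‖ * ‖y‖ := by gcongr; exact CStarModule.norm_inner_le E
        _ = ‖x‖ * ‖y‖ * ‖z‖ := by ring,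
    fun z w => by simp⟩

variable (A E) in
/-- The compact endomorphisms `K(E)`: the norm closure of the linear span of the rank one
endomorphisms. -/
def compacts : Set (AdjointableEnd A E) :=
  closure (Submodule.span ℂ {T : AdjointableEnd A E | ∃ x y : E, T = rankOne x y})

end AdjointableEnd

end Adjointable

/-! ### Closed submodules -/

section Submodules

variable (A E : Type*) [NonUnitalCStarAlgebra A] [PartialOrder A]
  [NormedAddCommGroup E] [NormedSpace ℂ E] [SMul A E] [CStarModule A E]

/-- A closed submodule of the Hilbert `A`-module `E`. -/
structure ClosedSub extends Submodule ℂ E where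
  act_mem : ∀ (a : A) {x : E}, x ∈ carrier → a • x ∈ carrier
  closed : IsClosed carrier

variable {A E}

/-- Two closed submodules of `E` are isomorphic as Hilbert `A`-modules: there is an `A`-linear
bijection which preserves the `A`-valued inner product. -/
def ClosedSub.Isomorphic (F G : ClosedSub A E) : Prop :=
  ∃ u : F.toSubmodule ≃ₗ[ℂ] G.toSubmodule,
    (∀ (a : A) (x : F.toSubmodule),
      u ⟨a • (x : E), F.act_mem a x.2⟩ = ⟨a • (u x : E), G.act_mem a (u x).2⟩) ∧
    ∀ x y : F.toSubmodule, inner A (u x : E) (u y : E) = inner A (x : E) (y : E)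

end Submodules

/-! ### Spectral projections -/

section Spectral

variable {A E : Type*} [NonUnitalCStarAlgebra A] [PartialOrder A] [StarOrderedRing A]
  [NormedAddCommGroup E] [NormedSpace ℂ E] [CompleteSpace E] [SMul A E] [CStarModule A E]

/-- Continuous functions `0 ≤ ramp t 0 ≤ ramp t 1 ≤ …` on `ℝ` with pointwise supremum the
characteristic function of `]t, +∞[`. -/
def ramp (t : ℝ) (n : ℕ) (s : ℝ) : ℝ := min 1 (n * max (s - t) 0)

theorem norm_cfc_ramp_le (h : AdjointableEnd A E) (t : ℝ) (n : ℕ) :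
    ‖(cfc (ramp t n) h).1‖ ≤ 1 := by
  refine norm_cfc_le (𝕜 := ℝ) (A := AdjointableEnd A E) zero_le_one fun s _ => ?_
  have h0 : 0 ≤ ramp t n s := le_min zero_le_one (by positivity)
  rw [Real.norm_of_nonneg h0]
  exact min_le_left _ _

/-- For a self-adjoint `h`, the closed submodule of `E` corresponding to the open projection
`p = 1_{]t, +∞]}(h)`, that is, `{ξ ∈ E | p ξ = ξ} = E ∩ p E''`.

Here `E''` is the bidual of `E`, in which `E` is embedded canonically, and `p` is the spectral
projection of `h` in the bidual `K(E)''`, i.e. the supremum (and weak⋆ limit) of the bounded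
increasing sequence `ramp t n (h)`, which is formed with the continuous functional calculus of
the C⋆-algebra `L(E) ⊆ K(E)''`.  So `p ξ` is the limit of `ramp t n (h) ξ` in the
topology `σ(E'', E')`, and `p ξ = ξ` says that `ramp t n (h) ξ` tends to `ξ` against every bounded
linear functional on `E`. -/
def spectralSub (h : AdjointableEnd A E) (t : ℝ) : ClosedSub A E where
  carrier := {ξ | ∀ l : StrongDual ℂ E,
    Tendsto (fun n : ℕ => l ((cfc (ramp t n) h).1 ξ)) atTop (𝓝 (l ξ))}
  zero_mem' l := by simp
  add_mem' {x y} hx hy l := by simpa using (hx l).add (hy l)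
  smul_mem' c x hx l := by simpa using (hx l).const_mul c
  act_mem a x hx l := by
    simpa [AdjointableEnd.map_smul] using hx (l.comp (lsmul a))
  closed := by
    refine isClosed_of_closure_subset fun ξ hξ l => ?_
    rw [Metric.tendsto_atTop]
    intro ε hε
    have hδ : 0 < ε / (3 * (‖l‖ + 1)) := by positivity
    obtain ⟨η, hη, hd⟩ := Metric.mem_closure_iff.mp hξ _ hδ
    obtain ⟨N, hN⟩ := Metric.tendsto_atTop.mp (hη l) (ε / 3) (by positivity)
    refine ⟨N, fun n hn => ?_⟩
    rw [dist_eq_norm] at hd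
    have h1 : ‖l‖ * ‖ξ - η‖ ≤ ε / 3 := by
      calc ‖l‖ * ‖ξ - η‖ ≤ (‖l‖ + 1) * (ε / (3 * (‖l‖ + 1))) := by
            gcongr; linarith
        _ = ε / 3 := by field_simp
    have h2 : ‖l ((cfc (ramp t n) h).1 ξ) - l ((cfc (ramp t n) h).1 η)‖ ≤ ε / 3 := by
      rw [← map_sub, ← map_sub]
      refine (l.le_opNorm _).trans (le_trans ?_ h1)
      gcongr
      exact ((cfc (ramp t n) h).1.le_opNorm _).trans
        (mul_le_of_le_one_left (norm_nonneg _) (norm_cfc_ramp_le h t n))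
    have h3 : ‖l η - l ξ‖ ≤ ε / 3 := by
      rw [← map_sub]
      refine (l.le_opNorm _).trans (le_trans (le_of_eq ?_) h1)
      rw [norm_sub_rev]
    have h4 := hN n hn
    rw [dist_eq_norm] at h4 ⊢
    calc _ = ‖(l ((cfc (ramp t n) h).1 ξ) - l ((cfc (ramp t n) h).1 η)) +
          (l ((cfc (ramp t n) h).1 η) - l η) + (l η - l ξ)‖ := by congr 1; ring
      _ < ε := (norm_add₃_le).trans_lt (by linarith)

end Spectral

end HilbertMod

end

/-! Put `p = (h₁ - t)₊` and `q = (h₂ - (t - ε))₊`, with square roots `s` and `r`. The submodules in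
the statement are the closed ranges of `p` and `q` (`closedRange_posPartSub`). Since `h₁ - t ≤ h₂ +
ε - t ≤ q`, compressing by `s` gives `p² ≤ s q s = |rs|²`. Take `x = rs` and `y = |rs|`. The
inequality puts `p` in the closed right ideal of `y`; conversely `y² = s q s` puts `y` in that of
`p`, so `p` and `y` have the same closed range. As `x*x = y*y`, the map `yξ ↦ xξ` extends to an
isomorphism of closed ranges (`closedRange_isomorphic`), and the closed range of `x` lies in that of
`r`, hence of `q`. Closed right ideals of `L(E)` carry the comparison
(`exists_comparison_posPartSub`). -/

namespace HilbertMod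

/-! ### Comparison of closed right ideals in a unital C⋆-algebra -/

section RightIdeal

variable {B : Type*} [CStarAlgebra B]

/-- The closed right ideal generated by `a`. -/
def closedRightIdeal (a : B) : Set B := closure (Set.range (a * ·))

theorem mul_mem_closedRightIdeal {a b : B} (hb : b ∈ closedRightIdeal a) (c : B) :
    b * c ∈ closedRightIdeal a :=
  map_mem_closure (f := (· * c)) (by fun_prop) hb (by
    rintro _ ⟨d, rfl⟩
    exact ⟨d * c, (mul_assoc a d c).symm⟩)

theorem self_mul_mem_closedRightIdeal (a c : B) : a * c ∈ closedRightIdeal a :=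
  subset_closure ⟨c, rfl⟩

theorem closedRightIdeal_trans {a b c : B} (hb : b ∈ closedRightIdeal a)
    (hc : c ∈ closedRightIdeal b) : c ∈ closedRightIdeal a :=
  closure_minimal (by rintro _ ⟨d, rfl⟩; exact mul_mem_closedRightIdeal hb d)
    isClosed_closure hc

/-- The positive part of `h - t`. -/
noncomputable def posPartSub (h : B) (t : ℝ) : B := cfc (fun s : ℝ => max (s - t) 0) h

/-- Take `s = √((h - t)₊)`. It vanishes where `h ≤ t`, so compressing `h - t` by it loses the
negative part. -/
theorem exists_sqrt_posPartSub {h : B} (hsa : IsSelfAdjoint h) (t : ℝ) :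
    ∃ s : B, IsSelfAdjoint s ∧ s * s = posPartSub h t ∧
      s * (h - algebraMap ℝ B t) * s = posPartSub h t * posPartSub h t := by
  set f : ℝ → ℝ := fun s => √(max (s - t) 0) with hf
  have hfc : Continuous f := by fun_prop
  refine ⟨cfc f h, cfc_predicate f h, ?_, ?_⟩
  · rw [posPartSub, ← cfc_mul f f h]
    exact cfc_congr fun s _ => Real.mul_self_sqrt (le_max_right _ _)
  · have h1 : h - algebraMap ℝ B t = cfc (fun s : ℝ => s - t) h := by
      rw [cfc_sub (fun s : ℝ => s) (fun _ => t) h, cfc_id' ℝ h, cfc_const t h]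
    rw [posPartSub, h1, ← cfc_mul f _ h, ← cfc_mul (fun s => f s * (s - t)) f h, ← cfc_mul _ _ h]
    refine cfc_congr fun s _ => ?_
    have h2 : f s * f s = max (s - t) 0 := Real.mul_self_sqrt (le_max_right _ _)
    calc f s * (s - t) * f s = f s * f s * (s - t) := by ring
      _ = max (s - t) 0 * max (s - t) 0 := by
        rw [h2]
        rcases le_total (s - t) 0 with h3 | h3
        · rw [max_eq_right h3]; ring
        · rw [max_eq_left h3]

variable [PartialOrder B] [StarOrderedRing B]

/-- The elements `a (a + δ)⁻¹ b` approximate `b`. With `f(a) = δ (a + δ)⁻¹`, the error `f(a) b` has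
squared norm at most `‖f(a) a f(a)‖ ≤ δ`, because `δ s ≤ (s + δ)²` for `s ≥ 0`. -/
theorem mem_closedRightIdeal_of_mul_star_le {a b : B} (h : b * star b ≤ a) :
    b ∈ closedRightIdeal a := by
  have ha : 0 ≤ a := (mul_star_self_nonneg b).trans h
  have hsa : IsSelfAdjoint a := ha.isSelfAdjoint
  refine Metric.mem_closure_iff.mpr fun ε hε => ?_
  obtain ⟨δ, hδ, hδε⟩ : ∃ δ : ℝ, 0 < δ ∧ δ < ε ^ 2 := exists_between (by positivity)
  -- The absolute value makes the functions continuous on all of `ℝ`; it is invisible on the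
  -- spectrum of `a ≥ 0`.
  have hne : ∀ s : ℝ, |s| + δ ≠ 0 := fun s => by positivity
  set g : ℝ → ℝ := fun s => (|s| + δ)⁻¹ with hg
  set f : ℝ → ℝ := fun s => δ * (|s| + δ)⁻¹ with hf
  have hgc : Continuous g := by
    rw [hg]; exact (by fun_prop : Continuous fun s : ℝ => |s| + δ).inv₀ hne
  have hfc : Continuous f := continuous_const.mul hgc
  have h1 : 1 - a * cfc g a = cfc f a := by
    have : a * cfc g a = cfc (fun s => s * g s) a := by
      rw [cfc_mul (fun s => s) g a continuousOn_id hgc.continuousOn, cfc_id' ℝ a]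
    rw [this, ← cfc_const_one ℝ a, ← cfc_sub (fun _ => (1 : ℝ)) (fun s => s * g s) a
      continuousOn_const (continuous_id.mul hgc).continuousOn]
    refine cfc_congr fun s hs => ?_
    have hs0 : 0 ≤ s := spectrum_nonneg_of_nonneg ha hs
    have := hne s
    simp only [hf, hg, abs_of_nonneg hs0] at this ⊢
    field_simp
    ring
  refine ⟨_, ⟨cfc g a * b, rfl⟩, ?_⟩
  have h2 : b - a * (cfc g a * b) = cfc f a * b := by
    rw [← h1]; noncomm_ring
  have hfsa : IsSelfAdjoint (cfc f a) := cfc_predicate f a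
  rw [dist_eq_norm, h2]
  refine lt_of_pow_lt_pow_left₀ 2 hε.le (lt_of_le_of_lt ?_ hδε)
  calc ‖cfc f a * b‖ ^ 2 = ‖cfc f a * (b * star b) * cfc f a‖ := by
        rw [sq, ← CStarRing.norm_self_mul_star, star_mul, hfsa.star_eq]
        simp only [mul_assoc]
    _ ≤ ‖cfc f a * a * cfc f a‖ := by
        refine CStarAlgebra.norm_le_norm_of_nonneg_of_le ?_ (hfsa.conjugate_le_conjugate h)
        exact hfsa.conjugate_nonneg (mul_star_self_nonneg b)
    _ = ‖cfc (fun s => f s * s * f s) a‖ := by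
        rw [cfc_mul (fun s => f s * s) f a (hfc.mul continuous_id).continuousOn hfc.continuousOn,
          cfc_mul f (fun s => s) a hfc.continuousOn continuousOn_id, cfc_id' ℝ a]
    _ ≤ δ := by
        refine norm_cfc_le hδ.le fun s hs => ?_
        have hs0 : 0 ≤ s := spectrum_nonneg_of_nonneg ha hs
        have hpos : 0 < s + δ := by positivity
        have : f s * s * f s = δ * (δ * s / (s + δ) ^ 2) := by
          simp only [hf, abs_of_nonneg hs0]; field_simp
        rw [this, Real.norm_of_nonneg (by positivity)]
        refine mul_le_of_le_one_right hδ.le ((div_le_one (by positivity)).mpr ?_)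
        nlinarith

theorem le_posPartSub_add {h : B} (hsa : IsSelfAdjoint h) (t : ℝ) :
    h ≤ posPartSub h t + algebraMap ℝ B t := by
  rw [posPartSub, ← cfc_add_const t (fun s : ℝ => max (s - t) 0) h]
  conv_lhs => rw [← cfc_id' ℝ h]
  refine cfc_mono fun s _ => ?_
  linarith [le_max_left (s - t) 0]

/-- If `h₁ ≤ h₂ + ε`, then `(h₁ - t)₊` generates the same closed right ideal as some `y`,
where `|y| = |x|` for some `x` in the closed right ideal generated by `(h₂ - (t - ε))₊`. -/
theorem exists_comparison_posPartSub {h₁ h₂ : B} (hsa₁ : IsSelfAdjoint h₁)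
    (hsa₂ : IsSelfAdjoint h₂) {ε : ℝ} (h : h₁ ≤ h₂ + algebraMap ℝ B ε) (t : ℝ) :
    ∃ x y : B, star x * x = star y * y ∧
      y ∈ closedRightIdeal (posPartSub h₁ t) ∧ posPartSub h₁ t ∈ closedRightIdeal y ∧
      x ∈ closedRightIdeal (posPartSub h₂ (t - ε)) := by
  obtain ⟨s, hs, hs2, hsh⟩ := exists_sqrt_posPartSub hsa₁ t
  obtain ⟨r, hr, hr2, -⟩ := exists_sqrt_posPartSub hsa₂ (t - ε)
  set p := posPartSub h₁ t
  set q := posPartSub h₂ (t - ε)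
  have hp : IsSelfAdjoint p := cfc_predicate _ _
  set y := CFC.abs (r * s)
  have hyy : y * y = s * q * s := by
    rw [CFC.abs_mul_abs, star_mul, hs.star_eq, hr.star_eq, ← hr2]
    simp only [mul_assoc]
  have hy : IsSelfAdjoint y := (CFC.abs_nonneg (r * s)).isSelfAdjoint
  -- The only use of `h₁ ≤ h₂ + ε`: it yields `h₁ - t ≤ q`, which is then conjugated by `s`.
  have hpq : p * p ≤ y * y := by
    rw [← hsh, hyy]
    refine hs.conjugate_le_conjugate ?_
    rw [sub_le_iff_le_add]
    calc h₁ ≤ h₂ + algebraMap ℝ B ε := h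
      _ ≤ q + algebraMap ℝ B (t - ε) + algebraMap ℝ B ε := by
        gcongr; exact le_posPartSub_add hsa₂ (t - ε)
      _ = q + algebraMap ℝ B t := by rw [add_assoc, ← map_add, sub_add_cancel]
  refine ⟨r * s, y, ?_, ?_, ?_, ?_⟩
  · rw [hy.star_eq, CFC.abs_mul_abs]
  · have h1 : s ∈ closedRightIdeal p :=
      mem_closedRightIdeal_of_mul_star_le (by rw [hs.star_eq, hs2])
    have h2 : y * y ∈ closedRightIdeal p := by
      rw [hyy, mul_assoc]; exact mul_mem_closedRightIdeal h1 _
    -- `y` lies in the closed right ideal of its own square, by the criterion with `a = y²`.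
    exact closedRightIdeal_trans h2
      (mem_closedRightIdeal_of_mul_star_le (by rw [hy.star_eq]))
  · exact closedRightIdeal_trans (self_mul_mem_closedRightIdeal y y)
      (mem_closedRightIdeal_of_mul_star_le (by rwa [hp.star_eq]))
  · exact mul_mem_closedRightIdeal
      (mem_closedRightIdeal_of_mul_star_le (by rw [hr.star_eq, hr2])) s

end RightIdeal

/-! ### Closed ranges and spectral submodules -/

section Range

variable {A E : Type*} [NonUnitalCStarAlgebra A] [PartialOrder A]
  [NormedAddCommGroup E] [NormedSpace ℂ E] [SMul A E] [CStarModule A E]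

theorem ClosedSub.ext_toSubmodule {F G : ClosedSub A E} (h : F.toSubmodule = G.toSubmodule) :
    F = G := by
  cases F; cases G; congr

/-- The closure of the range of an adjointable endomorphism. -/
def closedRange (T : AdjointableEnd A E) : ClosedSub A E where
  toSubmodule := (LinearMap.range T.1.toLinearMap).topologicalClosure
  act_mem a {x} hx := by
    refine map_mem_closure (lsmul (A := A) a : E →L[ℂ] E).continuous hx ?_
    rintro _ ⟨y, rfl⟩
    exact ⟨a • y, AdjointableEnd.map_smul T a y⟩
  closed := isClosed_closure

theorem apply_mem_closedRange (T : AdjointableEnd A E) (ξ : E) :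
    T.1 ξ ∈ (closedRange T).toSubmodule :=
  subset_closure ⟨ξ, rfl⟩

theorem closedRange_le {T : AdjointableEnd A E} {F : ClosedSub A E}
    (h : ∀ ξ, T.1 ξ ∈ F.toSubmodule) : (closedRange T).toSubmodule ≤ F.toSubmodule :=
  closure_minimal (by rintro _ ⟨ξ, rfl⟩; exact h ξ) F.closed

theorem inner_apply_eq_of_star_mul_self_eq {S T : AdjointableEnd A E}
    (h : star S * S = star T * T) (ξ η : E) :
    inner A (S.1 ξ) (S.1 η) = inner A (T.1 ξ) (T.1 η) := by
  rw [← AdjointableEnd.star_inner_right, ← AdjointableEnd.star_inner_right]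
  exact congrArg (fun R : AdjointableEnd A E => inner A ξ (R.1 η)) h

/-- The corestriction of `T` to the closure of its range. -/
def toClosedRange (T : AdjointableEnd A E) : E →ₗ[ℂ] (closedRange T).toSubmodule :=
  T.1.toLinearMap.codRestrict _ (apply_mem_closedRange T)

theorem denseRange_toClosedRange (T : AdjointableEnd A E) : DenseRange (toClosedRange T) := by
  intro x
  rw [closure_subtype, ← Set.range_comp]
  exact x.2

variable [StarOrderedRing A] [CompleteSpace E]

theorem closedRange_le_of_mem_closedRightIdeal {S T : AdjointableEnd A E}
    (h : S ∈ closedRightIdeal T) :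
    (closedRange S).toSubmodule ≤ (closedRange T).toSubmodule :=
  closedRange_le fun ξ => map_mem_closure (f := fun R : AdjointableEnd A E => R.1 ξ)
    ((ContinuousLinearMap.apply ℂ E ξ).continuous.comp continuous_subtype_val) h (by
      rintro _ ⟨R, rfl⟩
      exact ⟨R.1 ξ, rfl⟩)

/-- The equation makes `Sξ ↦ Tξ` well defined and isometric between dense subspaces. Its extension
to the closures replaces a polar decomposition, whose partial isometry need not be in `L(E)`;
`A`-linearity and inner products pass to the closures by density. -/
theorem closedRange_isomorphic {S T : AdjointableEnd A E} (h : star S * S = star T * T) :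
    (closedRange S).Isomorphic (closedRange T) := by
  have : CompleteSpace (closedRange S).toSubmodule :=
    (closedRange S).closed.completeSpace_coe
  have : CompleteSpace (closedRange T).toSubmodule :=
    (closedRange T).closed.completeSpace_coe
  have hin := inner_apply_eq_of_star_mul_self_eq h
  have hnorm (ξ : E) : ‖toClosedRange T ξ‖ = ‖toClosedRange S ξ‖ := by
    change ‖T.1 ξ‖ = ‖S.1 ξ‖
    rw [CStarModule.norm_eq_sqrt_norm_inner_self (A := A),
      CStarModule.norm_eq_sqrt_norm_inner_self (A := A) (x := S.1 ξ), hin]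
  set u := (LinearEquiv.refl ℂ E).extendOfIsometry (toClosedRange S) (toClosedRange T)
    (denseRange_toClosedRange S) (denseRange_toClosedRange T) hnorm
  have hu (ξ : E) : u (toClosedRange S ξ) = toClosedRange T ξ :=
    (LinearEquiv.refl ℂ E).extendOfIsometry_eq _ _ (denseRange_toClosedRange S)
      (denseRange_toClosedRange T) hnorm ξ
  have hinu (x y : (closedRange S).toSubmodule) :
      inner A (u x : E) (u y : E) = inner A (x : E) (y : E) := by
    refine (denseRange_toClosedRange S).induction_on₂
      (p := fun x y => inner A (u x : E) (u y : E) = inner A (x : E) (y : E)) ?_ ?_ x y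
    · refine isClosed_eq ?_ ?_
      · exact CStarModule.continuous_inner.comp (f := fun z :
          (closedRange S).toSubmodule × (closedRange S).toSubmodule => ((u z.1 : E), (u z.2 : E)))
          (by fun_prop)
      · exact CStarModule.continuous_inner.comp (f := fun z :
          (closedRange S).toSubmodule × (closedRange S).toSubmodule => ((z.1 : E), (z.2 : E)))
          (by fun_prop)
    · intro ξ η
      rw [hu, hu]
      exact (hin ξ η).symm
  refine ⟨u.toLinearEquiv, fun a x => ?_, hinu⟩
  have hc (F : ClosedSub A E) : Continuous fun x : F.toSubmodule =>
      (⟨a • (x : E), F.act_mem a x.2⟩ : F.toSubmodule) :=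
    ((lsmul (A := A) a : E →L[ℂ] E).continuous.comp continuous_subtype_val).subtype_mk _
  change u _ = _
  refine (denseRange_toClosedRange S).induction_on
    (p := fun x => u ⟨a • (x : E), (closedRange S).act_mem a x.2⟩ =
      ⟨a • (u x : E), (closedRange T).act_mem a (u x).2⟩) x ?_ fun ξ => ?_
  · exact isClosed_eq (u.continuous.comp (hc _)) ((hc _).comp u.continuous)
  · have h1 (R : AdjointableEnd A E) :
        (⟨a • (toClosedRange R ξ : E), (closedRange R).act_mem a (toClosedRange R ξ).2⟩ :
          (closedRange R).toSubmodule) = toClosedRange R (a • ξ) :=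
      Subtype.ext (AdjointableEnd.map_smul R a ξ).symm
    rw [h1, hu]
    refine (h1 T).symm.trans (Subtype.ext ?_)
    change a • (toClosedRange T ξ : E) = a • (u (toClosedRange S ξ) : E)
    rw [hu]

theorem continuous_ramp (t : ℝ) (n : ℕ) : Continuous (ramp t n) := by
  unfold ramp; fun_prop

/-- With `m = (s - t)₊`, the difference vanishes when `m ≥ 1/n` and is at most `m ≤ 1/n` otherwise.
-/
theorem norm_cfc_ramp_mul_posPartSub_sub_le (h : AdjointableEnd A E) (t : ℝ) {n : ℕ}
    (hn : 0 < n) : ‖cfc (ramp t n) h * posPartSub h t - posPartSub h t‖ ≤ 1 / (n : ℝ) := by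
  have hr : Continuous (ramp t n) := continuous_ramp t n
  have hm : Continuous fun s : ℝ => max (s - t) 0 := by fun_prop
  rw [posPartSub, ← cfc_mul _ _ h hr.continuousOn hm.continuousOn,
    ← cfc_sub (fun s => ramp t n s * max (s - t) 0) _ h (hr.mul hm).continuousOn hm.continuousOn]
  refine norm_cfc_le (by positivity) fun s _ => ?_
  simp only [ramp]
  have hs : 0 ≤ max (s - t) 0 := le_max_right _ _
  set m := max (s - t) 0
  have hn' : (0 : ℝ) < n := by exact_mod_cast hn
  rw [Real.norm_eq_abs]
  rcases le_total 1 (n * m) with h1 | h1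
  · rw [min_eq_left h1, one_mul, sub_self, abs_zero]; positivity
  · have h2 : m ≤ 1 / n := (le_div_iff₀' hn').mpr h1
    have h3 : 0 ≤ n * m := by positivity
    rw [min_eq_right h1, abs_le]
    constructor <;> nlinarith

/-- The ramp is exactly divisible by `m = (s - t)₊`: `min(1, nm) = m · n / max(1, nm)`, with a
continuous quotient. -/
theorem cfc_ramp_mem_closedRightIdeal {h : AdjointableEnd A E} (t : ℝ) (n : ℕ) :
    cfc (ramp t n) h ∈ closedRightIdeal (posPartSub h t) := by
  have hm : Continuous fun s : ℝ => max (s - t) 0 := by fun_prop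
  have hg : Continuous fun s : ℝ => n / max 1 (n * max (s - t) 0) :=
    continuous_const.div (by fun_prop) fun s => (zero_lt_one.trans_le (le_max_left _ _)).ne'
  have h1 : cfc (ramp t n) h =
      posPartSub h t * cfc (fun s : ℝ => n / max 1 (n * max (s - t) 0)) h := by
    rw [posPartSub, ← cfc_mul _ _ h hm.continuousOn hg.continuousOn]
    refine cfc_congr fun s _ => ?_
    simp only [ramp]
    set m := max (s - t) 0
    rcases le_total 1 (n * m) with h1 | h1
    · rw [min_eq_left h1, max_eq_right h1, mul_div_assoc', mul_comm m,
        div_self (zero_lt_one.trans_le h1).ne']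
    · rw [min_eq_right h1, max_eq_left h1, div_one, mul_comm]
  rw [h1]
  exact self_mul_mem_closedRightIdeal _ _

/-- The ramps act as left approximate units on `(h - t)₊` in norm, which gives one inclusion. For
the other, each `ramp t n (h) ξ` lies in the closed range, and a norm-closed subspace is weakly
closed. -/
theorem closedRange_posPartSub (h : AdjointableEnd A E) (t : ℝ) :
    (closedRange (posPartSub h t)).toSubmodule = (spectralSub h t).toSubmodule := by
  refine le_antisymm (closedRange_le fun ξ l => ?_) fun ξ hξ => ?_
  · have h1 : Tendsto (fun n => cfc (ramp t n) h * posPartSub h t) atTop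
        (𝓝 (posPartSub h t)) := by
      refine tendsto_iff_norm_sub_tendsto_zero.mpr (squeeze_zero'
        (.of_forall fun _ => norm_nonneg _) ?_ (tendsto_const_div_atTop_nhds_zero_nat 1))
      filter_upwards [eventually_gt_atTop 0] with n hn
      exact norm_cfc_ramp_mul_posPartSub_sub_le h t hn
    exact (((l.comp (ContinuousLinearMap.apply ℂ E ξ)).continuous.comp
      continuous_subtype_val).tendsto _).comp h1
  · by_contra hne
    -- A functional strictly separating `ξ` from the closed range would contradict weak convergence
    -- of the ramps applied to `ξ`.
    obtain ⟨l, u, hl, hu⟩ := RCLike.geometric_hahn_banach_closed_point (𝕜 := ℂ)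
      ((closedRange (posPartSub h t)).toSubmodule.restrictScalars ℝ).convex
      (closedRange (posPartSub h t)).closed hne
    refine hu.not_ge (le_of_tendsto ((RCLike.continuous_re.tendsto _).comp (hξ l)) ?_)
    exact .of_forall fun n => (hl _ (closedRange_le_of_mem_closedRightIdeal
      (cfc_ramp_mem_closedRightIdeal t n) (apply_mem_closedRange _ ξ))).le

end Range

end HilbertMod

theorem corollary9p1 {A E : Type*} [NonUnitalCStarAlgebra A] [PartialOrder A] [StarOrderedRing A]
    [NormedAddCommGroup E] [NormedSpace ℂ E] [CompleteSpace E] [SMul A E] [CStarModule A E]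
    (h₁ h₂ : HilbertMod.AdjointableEnd A E)
    (hsa₁ : IsSelfAdjoint h₁) (hsa₂ : IsSelfAdjoint h₂)
    (hc₁ : h₁ ∈ HilbertMod.AdjointableEnd.compacts A E)
    (hc₂ : h₂ ∈ HilbertMod.AdjointableEnd.compacts A E)
    (ε : ℝ) (hε : ‖h₁ - h₂‖ ≤ ε) (t : ℝ) :
    ∃ F : HilbertMod.ClosedSub A E,
      F.toSubmodule ≤ (HilbertMod.spectralSub h₂ (t - ε)).toSubmodule ∧
      (HilbertMod.spectralSub h₁ t).Isomorphic F := by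
  -- The order on `L(E)` is the one in which `a ≤ b` means that `b - a` is self-adjoint with
  -- nonnegative spectrum.
  let _ := CStarAlgebra.spectralOrder (HilbertMod.AdjointableEnd A E)
  have := CStarAlgebra.spectralOrderedRing (HilbertMod.AdjointableEnd A E)
  have hle : h₁ ≤ h₂ + algebraMap ℝ (HilbertMod.AdjointableEnd A E) ε := by
    rw [← sub_le_iff_le_add']
    exact (hsa₁.sub hsa₂).le_algebraMap_norm_self.trans (algebraMap_mono _ hε)
  obtain ⟨x, y, hxy, hyp, hpy, hx⟩ :=
    HilbertMod.exists_comparison_posPartSub hsa₁ hsa₂ hle t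
  have hy : HilbertMod.spectralSub h₁ t = HilbertMod.closedRange y := by
    refine HilbertMod.ClosedSub.ext_toSubmodule ?_
    rw [← HilbertMod.closedRange_posPartSub]
    exact le_antisymm (HilbertMod.closedRange_le_of_mem_closedRightIdeal hpy)
      (HilbertMod.closedRange_le_of_mem_closedRightIdeal hyp)
  refine ⟨HilbertMod.closedRange x, ?_, ?_⟩
  · rw [← HilbertMod.closedRange_posPartSub]
    exact HilbertMod.closedRange_le_of_mem_closedRightIdeal hx
  · rw [hy]
    exact HilbertMod.closedRange_isomorphic hxy.symm
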